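/- A probabilistic pushdown automaton (pPDA) $\Delta$ has a finite state set $Q$, a finite stack alphabet $\Gamma$, and non-negative rational weights of transitions $pZ \xrightarrow{a} q\alpha$ with $p,q\in Q$, $Z\in\Gamma$, $\alpha\in\Gamma^*$, $|\alpha|\le 2$, which sum to $1$ for every $pZ$; a transition takes the configuration $pZ\beta$ to $q\alpha\beta$ ($\beta\in\Gamma^*$), and configurations with empty stack have no successors. For $pZq\in Q\times\Gamma\times Q$ let $[pZ|q]=\sum_\pi p(\pi)$ and $E[pZ|q]=\sum_\pi p(\pi)\,|\pi|$, where $\pi$ ranges over the finite paths from $pZ$ to $q\varepsilon$, $p(\pi)$ is the product of the transition weights along $\pi$ and $|\pi|$ is the number of steps. $\Delta$ is cPAST if $E[pZ|q]/[pZ|q]<\infty$ whenever $[pZ|q]>0$. The fundamental system $f$ of $\Delta$ is the system of polynomials $$f_{pZq}=\sum_{pZ\xrightarrow{a}q\varepsilon}a+\sum_{pZ\xrightarrow{a}rY}a\,x_{rYq}+\sum_{pZ\xrightarrow{a}rYX}a\sum_{t\in Q}x_{rYt}\,x_{tXq},$$ with least fixed point $\mu f\in[0,\infty]^{Q\times\Gamma\times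 Q}$. The cleaned-up system $\hat f$ is obtained from $f$ by removing every variable $x_j$ with $(\mu f)_j=0$ (its equation is dropped and $x_j$ is replaced by $0$ elsewhere). Let $\hat f'(u)$ be the Jacobi matrix of $\hat f$ at $u$, and $\rho$ the spectral radius. Lemma (bound on spectrum). Let $\Delta$ be a cPAST pPDA with at least one positive return probability $[pZ|q]$, and let $\hat f$ be its cleaned-up fundamental system. Let $C=\max\{E[pZ|q]/[pZ|q] : [pZ|q]>0\}$ be the maximal conditional expected runtime and $m=\min\{[pZ|q] : [pZ|q]>0\}$ the minimal non-zero return probability (the smallest entry of $\mu\hat f$). Then $1\le C<\infty$, all entries of $\mu\hat f$ are finite, and there is a vector $v$ with all $v_i>0$ and $\|v\|_1=1$ such that $\hat f'(\mu\hat f)\,v\le(1-C^{-1})\,v$ entrywise and $\min_i v_i\ge \dfrac{m}{C\,|Q|^2\,|\Gamma|}$. Moreover $\rho(\hat f'(\mu\hat f))\le 1-C^{-1}$. The last bound is tight: for every rational $a$ with $\tfrac12<a\le 1$, the pPDA with a single state $p$, a single stack symbol $Z$ and the transitions $pZ\xrightarrow{a}p\varepsilon$ and $pZ\xrightarrow{1-a}pZZ$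 is cPAST with $C=\frac1{2a-1}$ and $\rho(\hat f'(\mu\hat f))=2(1-a)=1-C^{-1}$. -/

import Mathlib

open scoped NNReal ENNReal

noncomputable section

/-! ### Weighted transition systems and termination moments -/

/-- Weight of a finite path `s₀ s₁ … s_l`: the product of the weights of its steps
(`1` for a path of length zero). -/
def pathWeight {S : Type*} (M : S → S → ℝ≥0) : List S → ℝ≥0∞
  | [] => 1
  | [_] => 1
  | s :: t :: π => (M s t : ℝ≥0∞) * pathWeight M (t :: π)

/-- `π` is a proper path from `s` to `F`: it starts in `s`, ends in `F`, and visits `F` only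
at its end. For `s ∈ F` the only such path is `[s]`. -/
def IsProperPath {S : Type*} (s : S) (F : Set S) (π : List S) : Prop :=
  π.head? = some s ∧ (∃ t ∈ F, π.getLast? = some t) ∧ ∀ t ∈ π.dropLast, t ∉ F

/-- The `k`-th termination moment: the sum of `p(π) * |π| ^ k` over all proper paths from `s` to
`F`. The length `|π|` of a path is its number of steps; `0 ^ 0 = 1`. -/
def terminationMoment {S : Type*} (M : S → S → ℝ≥0) (k : ℕ) (s : S) (F : Set S) : ℝ≥0∞ :=
  ∑' π : {π : List S // IsProperPath s F π},
    pathWeight M π.1 * ((π.1.length - 1 : ℕ) : ℝ≥0∞) ^ k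

/-! ### Positive polynomial systems -/

/-- A positive polynomial system over the variables `J`: one polynomial with non-negative real
coefficients for each variable. -/
abbrev PPS (J : Type*) := J → MvPolynomial J ℝ≥0

namespace PPS

variable {J : Type*}

/-- The monotone endofunction of `[0,∞]^J` induced by a positive polynomial system. -/
def toFun (f : PPS J) : (J → ℝ≥0∞) →o (J → ℝ≥0∞) where
  toFun u i := (f i).eval₂ ENNReal.ofNNRealHom u
  monotone' := by
    intro u v huv i
    simp only [MvPolynomial.eval₂_eq]
    gcongr with d _ j _
    exact huv j

/-- The least fixed point in `[0,∞]^J`. -/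
def lfp (f : PPS J) : J → ℝ≥0∞ := OrderHom.lfp f.toFun

/-- The indices of the cleaned-up system: the variables that are non-zero in the least fixed
point. -/
def CleanIndex (f : PPS J) : Type _ := {j : J // f.lfp j ≠ 0}

instance (f : PPS J) [Finite J] : Finite f.CleanIndex :=
  inferInstanceAs (Finite {j : J // f.lfp j ≠ 0})

instance (f : PPS J) [Finite J] : Fintype f.CleanIndex := Fintype.ofFinite _

instance (f : PPS J) : DecidableEq f.CleanIndex := Classical.decEq _

open Classical in
/-- The cleaned-up system: the variables that are zero in the least fixed point are removed,
that is, their equations are dropped and they are replaced by `0` in the other equations. -/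
def clean (f : PPS J) : PPS f.CleanIndex := fun i =>
  MvPolynomial.bind₁
    (fun j => if h : f.lfp j ≠ 0 then MvPolynomial.X (⟨j, h⟩ : f.CleanIndex) else 0) (f i.1)

/-- The Jacobi matrix of partial derivatives, evaluated at a finite point `u`. -/
def jacobi (f : PPS J) (u : J → ℝ≥0) : Matrix J J ℝ :=
  Matrix.of fun i j => ((MvPolynomial.eval u (MvPolynomial.pderiv j (f i)) : ℝ≥0) : ℝ)

/-- The Jacobi matrix at the least fixed point. It is meaningful for feasible systems, that is,
when all entries of the least fixed point are finite. -/
def jacobiLfp (f : PPS J) : Matrix J J ℝ := f.jacobi fun j => (f.lfp j).toNNReal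

end PPS

/-! ### Weighted and probabilistic pushdown automata -/

/-- A weighted pushdown automaton with states `Q` and stack alphabet `Γ`; every transition
replaces the top stack symbol by a word of length at most two. Weight `0` means that there is no
transition. -/
structure WeightedPDA (Q Γ : Type*) where
  /-- `pop p Z q` is the weight of the transition from `pZ` to `qε`. -/
  pop : Q → Γ → Q → ℚ≥0
  /-- `swap p Z q Y` is the weight of the transition from `pZ` to `qY`. -/
  swap : Q → Γ → Q → Γ → ℚ≥0
  /-- `push p Z q Y X` is the weight of the transition from `pZ` to `qYX`, with `Y` on top. -/
  push : Q → Γ → Q → Γ → Γ → ℚ≥0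

namespace WeightedPDA

variable {Q Γ : Type*} [Fintype Q] [Fintype Γ]

/-- The weights of the transitions leaving any given `pZ` sum to one. -/
def IsProbabilistic (Δ : WeightedPDA Q Γ) : Prop :=
  ∀ p Z, (∑ q, Δ.pop p Z q) + (∑ q, ∑ Y, Δ.swap p Z q Y)
    + (∑ q, ∑ Y, ∑ X, Δ.push p Z q Y X) = 1

/-- The transition matrix on the configurations `Q × Γ*`; configurations with empty stack have no
outgoing transitions. -/
def transMatrix [DecidableEq Γ] (Δ : WeightedPDA Q Γ) : Q × List Γ → Q × List Γ → ℝ≥0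
  | (_, []), _ => 0
  | (p, Z :: β), (q, γ) =>
      (((if γ = β then Δ.pop p Z q else 0)
        + (∑ Y, if γ = Y :: β then Δ.swap p Z q Y else 0)
        + (∑ Y, ∑ X, if γ = Y :: X :: β then Δ.push p Z q Y X else 0) : ℚ≥0) : ℝ≥0)

/-- The return probability `[pZ|q]`: the zeroth termination moment from `pZ` to `qε`. -/
def returnProb [DecidableEq Γ] (Δ : WeightedPDA Q Γ) (p : Q) (Z : Γ) (q : Q) : ℝ≥0∞ :=
  terminationMoment Δ.transMatrix 0 (p, [Z]) {(q, [])}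

/-- The first termination moment `E[pZ|q]` from `pZ` to `qε`. -/
def firstMoment [DecidableEq Γ] (Δ : WeightedPDA Q Γ) (p : Q) (Z : Γ) (q : Q) : ℝ≥0∞ :=
  terminationMoment Δ.transMatrix 1 (p, [Z]) {(q, [])}

/-- The conditional expected runtime; used only where the return probability is positive. -/
def condRuntime [DecidableEq Γ] (Δ : WeightedPDA Q Γ) (p : Q) (Z : Γ) (q : Q) : ℝ≥0∞ :=
  Δ.firstMoment p Z q / Δ.returnProb p Z q

/-- Conditionally positively almost-surely terminating: all conditional expected runtimes that
are defined are finite. -/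
def IsCPAST [DecidableEq Γ] (Δ : WeightedPDA Q Γ) : Prop :=
  ∀ p Z q, 0 < Δ.returnProb p Z q → Δ.condRuntime p Z q < ⊤

/-- The maximal conditional expected runtime (a supremum over a finite set). -/
def maxCondRuntime [DecidableEq Γ] (Δ : WeightedPDA Q Γ) : ℝ≥0∞ :=
  ⨆ (p : Q) (Z : Γ) (q : Q) (_ : 0 < Δ.returnProb p Z q), Δ.condRuntime p Z q

/-- The minimal non-zero return probability (an infimum over a finite set). -/
def minReturnProb [DecidableEq Γ] (Δ : WeightedPDA Q Γ) : ℝ≥0∞ :=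
  ⨅ (p : Q) (Z : Γ) (q : Q) (_ : 0 < Δ.returnProb p Z q), Δ.returnProb p Z q

/-- The fundamental system: the quadratic system for the return probabilities, with one variable
for each triple `pZq`. -/
def fundamentalPPS (Δ : WeightedPDA Q Γ) : PPS (Q × Γ × Q) := fun ⟨p, Z, q⟩ =>
  MvPolynomial.C (Δ.pop p Z q : ℝ≥0)
    + (∑ r, ∑ Y, MvPolynomial.C (Δ.swap p Z r Y : ℝ≥0) * MvPolynomial.X (r, Y, q))
    + ∑ r, ∑ Y, ∑ X, MvPolynomial.C (Δ.push p Z r Y X : ℝ≥0)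
        * ∑ t, MvPolynomial.X (r, Y, t) * MvPolynomial.X (t, X, q)

/-- The cleaned-up fundamental system. -/
abbrev cleanPPS (Δ : WeightedPDA Q Γ) : PPS Δ.fundamentalPPS.CleanIndex :=
  Δ.fundamentalPPS.clean

end WeightedPDA

/-- Spectral radius of a finite real matrix: the largest absolute value of its complex
eigenvalues. -/
def specRad {J : Type*} [Fintype J] [DecidableEq J] (A : Matrix J J ℝ) : ℝ≥0∞ :=
  spectralRadius ℂ (A.map (algebraMap ℝ ℂ))

/-- The automaton with one state `p`, one stack symbol `Z` and the transitions from `pZ` to `pε`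
with weight `a` and from `pZ` to `pZZ` with weight `1 - a` (for `a ≤ 1`). -/
def branchingPDA (a : ℚ≥0) : WeightedPDA Unit Unit where
  pop _ _ _ := a
  swap _ _ _ _ := 0
  push _ _ _ _ _ := 1 - a

end

/-!
Decomposing a run at its first step gives, for the vectors `μ` of return probabilities and `E` of
first moments, `μ = f μ` and, by the Leibniz rule for convolutions, `E = μ + f'(μ) E`. Since
`E ≤ C μ`, this reads `f'(μ) E = E - μ ≤ (1 - C⁻¹) E`; as `E` is positive on the cleaned-up
variables, it bounds the spectral radius of the nonnegative matrix `f'(μ)`, and its normalization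
is the vector `v`. If `E` is a multiple of `μ`, as it must be for a single variable, then `E` is
an eigenvector and the bound is attained.
-/

section PathSums

variable {S : Type*} {M : S → S → ℝ≥0} {F : Set S} {s : S}

theorem isProperPath_singleton {t : S} : IsProperPath s F [t] ↔ t = s ∧ s ∈ F := by
  simp only [IsProperPath, List.head?_cons, List.getLast?_singleton, List.dropLast_singleton,
    Option.some.injEq]
  aesop

theorem isProperPath_cons_cons {r t : S} {π : List S} :
    IsProperPath s F (r :: t :: π) ↔ r = s ∧ s ∉ F ∧ IsProperPath t F (t :: π) := by
  simp only [IsProperPath, List.head?_cons, Option.some.injEq, List.getLast?_cons_cons,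
    List.dropLast_cons_cons, List.forall_mem_cons, true_and]
  aesop

theorem IsProperPath.exists_eq_cons {π : List S} (h : IsProperPath s F π) :
    ∃ π', π = s :: π' := by
  obtain ⟨π', rfl⟩ := List.head?_eq_some_iff.mp h.1
  exact ⟨π', rfl⟩

/-- The total weight of the proper paths from `s` to `F` with exactly `n` steps; every
termination moment is a moment of this sequence. -/
noncomputable def hitWeight (M : S → S → ℝ≥0) (F : Set S) (n : ℕ) (s : S) : ℝ≥0∞ :=
  ∑' π, {π | IsProperPath s F π ∧ π.length = n + 1}.indicator (pathWeight M) π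

theorem terminationMoment_eq_tsum_hitWeight (M : S → S → ℝ≥0) (k : ℕ) (s : S) (F : Set S) :
    terminationMoment M k s F = ∑' n : ℕ, hitWeight M F n s * (n : ℝ≥0∞) ^ k := by
  simp only [hitWeight, ← ENNReal.tsum_mul_right]
  rw [ENNReal.tsum_comm]
  refine (tsum_subtype {π | IsProperPath s F π}
    fun π => pathWeight M π * ((π.length - 1 : ℕ) : ℝ≥0∞) ^ k).trans ?_
  refine tsum_congr fun π => ?_
  by_cases hπ : IsProperPath s F π
  · obtain ⟨π', rfl⟩ := hπ.exists_eq_cons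
    rw [tsum_eq_single π'.length]
    · simp [hπ]
    · intro n hn
      simp [hπ, hn.symm]
  · simp [hπ]

theorem hitWeight_zero_of_mem (M : S → S → ℝ≥0) (hs : s ∈ F) : hitWeight M F 0 s = 1 := by
  rw [hitWeight, tsum_eq_single [s]]
  · simp [isProperPath_singleton, hs, pathWeight]
  · intro π hπ
    refine Set.indicator_of_notMem ?_ _
    rintro ⟨h, hlen⟩
    obtain ⟨π', rfl⟩ := h.exists_eq_cons
    simp_all

theorem hitWeight_zero_of_notMem (M : S → S → ℝ≥0) (hs : s ∉ F) : hitWeight M F 0 s = 0 := by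
  refine ENNReal.tsum_eq_zero.mpr fun π => Set.indicator_of_notMem ?_ _
  rintro ⟨h, hlen⟩
  obtain ⟨t, rfl⟩ := List.length_eq_one_iff.mp hlen
  exact hs (isProperPath_singleton.mp h).2

theorem hitWeight_succ_of_mem (M : S → S → ℝ≥0) (n : ℕ) (hs : s ∈ F) :
    hitWeight M F (n + 1) s = 0 := by
  refine ENNReal.tsum_eq_zero.mpr fun π => Set.indicator_of_notMem ?_ _
  rintro ⟨h, hlen⟩
  match π with
  | [] | [_] => simp at hlen
  | _ :: _ :: _ => exact (isProperPath_cons_cons.mp h).2.1 hs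

theorem hitWeight_succ_of_notMem (M : S → S → ℝ≥0) (n : ℕ) (hs : s ∉ F) :
    hitWeight M F (n + 1) s = ∑' t, (M s t : ℝ≥0∞) * hitWeight M F n t := by
  have hinj : Function.Injective (fun π : List S => s :: π) := List.cons_injective
  rw [hitWeight, ← hinj.tsum_eq]
  · simp only [hitWeight, ← ENNReal.tsum_mul_left]
    rw [ENNReal.tsum_comm]
    refine tsum_congr fun π => ?_
    rcases π with _ | ⟨t, π⟩
    · simp
    · rw [tsum_eq_single t]
      · classical
        simp [Set.indicator_apply, isProperPath_cons_cons, hs, pathWeight]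
      · intro u hu
        rw [Set.indicator_of_notMem, mul_zero]
        rintro ⟨h, -⟩
        exact hu (by simpa using h.1.symm)
  · intro π hπ
    obtain ⟨π', rfl⟩ := (Set.mem_of_indicator_ne_zero hπ).1.exists_eq_cons
    exact ⟨π', rfl⟩

theorem terminationMoment_zero_eq_tsum : terminationMoment M 0 s F = ∑' n, hitWeight M F n s := by
  simp [terminationMoment_eq_tsum_hitWeight]

theorem terminationMoment_one_eq_tsum :
    terminationMoment M 1 s F = ∑' n : ℕ, hitWeight M F n s * n := by
  simp [terminationMoment_eq_tsum_hitWeight]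

theorem terminationMoment_zero_of_mem (M : S → S → ℝ≥0) (hs : s ∈ F) :
    terminationMoment M 0 s F = 1 := by
  rw [terminationMoment_zero_eq_tsum, tsum_eq_zero_add' ENNReal.summable,
    hitWeight_zero_of_mem M hs]
  simp [hitWeight_succ_of_mem M _ hs]

theorem terminationMoment_one_of_mem (M : S → S → ℝ≥0) (hs : s ∈ F) :
    terminationMoment M 1 s F = 0 := by
  rw [terminationMoment_one_eq_tsum, tsum_eq_zero_add' ENNReal.summable]
  simp [hitWeight_succ_of_mem M _ hs]

theorem terminationMoment_zero_of_notMem (M : S → S → ℝ≥0) (hs : s ∉ F) :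
    terminationMoment M 0 s F = ∑' t, (M s t : ℝ≥0∞) * terminationMoment M 0 t F := by
  rw [terminationMoment_zero_eq_tsum, tsum_eq_zero_add' ENNReal.summable]
  simp only [hitWeight_zero_of_notMem M hs, hitWeight_succ_of_notMem M _ hs, zero_add]
  rw [ENNReal.tsum_comm]
  simp only [ENNReal.tsum_mul_left, terminationMoment_zero_eq_tsum]

theorem terminationMoment_one_of_notMem (M : S → S → ℝ≥0) (hs : s ∉ F) :
    terminationMoment M 1 s F
      = terminationMoment M 0 s F + ∑' t, (M s t : ℝ≥0∞) * terminationMoment M 1 t F := by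
  rw [terminationMoment_zero_of_notMem M hs, terminationMoment_one_eq_tsum,
    tsum_eq_zero_add' ENNReal.summable]
  simp only [hitWeight_succ_of_notMem M _ hs, Nat.cast_zero, mul_zero, zero_add, Nat.cast_succ,
    mul_add_one, ENNReal.tsum_add, terminationMoment_zero_eq_tsum, terminationMoment_one_eq_tsum,
    ← ENNReal.tsum_mul_left, ← ENNReal.tsum_mul_right]
  rw [add_comm, ENNReal.tsum_comm]
  congr 1
  rw [ENNReal.tsum_comm]
  simp only [mul_assoc]

theorem terminationMoment_one_eq_zero (h : terminationMoment M 0 s F = 0) :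
    terminationMoment M 1 s F = 0 := by
  rw [terminationMoment_zero_eq_tsum, ENNReal.tsum_eq_zero] at h
  simp [terminationMoment_one_eq_tsum, h]

theorem terminationMoment_zero_le_terminationMoment_one (M : S → S → ℝ≥0) (hs : s ∉ F) :
    terminationMoment M 0 s F ≤ terminationMoment M 1 s F :=
  (terminationMoment_one_of_notMem M hs).symm ▸ le_self_add

theorem terminationMoment_zero_le_of_superharmonic {h : S → ℝ≥0∞} (hF : ∀ s ∈ F, 1 ≤ h s)
    (hM : ∀ s ∉ F, ∑' t, (M s t : ℝ≥0∞) * h t ≤ h s) (s : S) :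
    terminationMoment M 0 s F ≤ h s := by
  rw [terminationMoment_zero_eq_tsum, ENNReal.tsum_eq_iSup_nat]
  refine iSup_le fun N => ?_
  induction N generalizing s with
  | zero => simp
  | succ N ih =>
    rw [Finset.sum_range_succ']
    by_cases hs : s ∈ F
    · simpa [hitWeight_succ_of_mem M _ hs, hitWeight_zero_of_mem M hs] using hF s hs
    · simp only [hitWeight_succ_of_notMem M _ hs, hitWeight_zero_of_notMem M hs, add_zero]
      rw [← Summable.tsum_finsetSum fun _ _ => ENNReal.summable]
      simp only [← Finset.mul_sum]
      exact (ENNReal.tsum_le_tsum fun t => mul_le_mul_right (ih t) _).trans (hM s hs)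

theorem terminationMoment_zero_le_one (hM : ∀ s ∉ F, ∑' t, (M s t : ℝ≥0∞) ≤ 1) (s : S) :
    terminationMoment M 0 s F ≤ 1 :=
  terminationMoment_zero_le_of_superharmonic (h := fun _ => 1) (fun _ _ => le_rfl)
    (by simpa using hM) s

theorem terminationMoment_one_le_of_drift {h : S → ℝ≥0∞}
    (hM : ∀ s ∉ F, terminationMoment M 0 s F + ∑' t, (M s t : ℝ≥0∞) * h t ≤ h s) (s : S) :
    terminationMoment M 1 s F ≤ h s := by
  rw [terminationMoment_one_eq_tsum, ENNReal.tsum_eq_iSup_nat]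
  refine iSup_le fun N => ?_
  induction N generalizing s with
  | zero => simp
  | succ N ih =>
    rw [Finset.sum_range_succ']
    by_cases hs : s ∈ F
    · simp [hitWeight_succ_of_mem M _ hs]
    · simp only [Nat.cast_zero, mul_zero, add_zero, Nat.cast_succ, mul_add_one,
        Finset.sum_add_distrib]
      rw [add_comm]
      refine (add_le_add ?_ ?_).trans (hM s hs)
      · rw [terminationMoment_zero_eq_tsum, tsum_eq_zero_add' ENNReal.summable]
        exact (ENNReal.sum_le_tsum _).trans le_add_self
      · simp only [hitWeight_succ_of_notMem M _ hs, ← ENNReal.tsum_mul_right]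
        rw [← Summable.tsum_finsetSum fun _ _ => ENNReal.summable]
        refine ENNReal.tsum_le_tsum fun t => ?_
        simp only [mul_assoc, ← Finset.mul_sum]
        exact mul_le_mul_right (ih t) _

end PathSums

section Convolution

open Finset

theorem tsum_sum_antidiagonal_mul (f g : ℕ → ℝ≥0∞) :
    ∑' n, ∑ x ∈ antidiagonal n, f x.1 * g x.2 = (∑' n, f n) * ∑' n, g n := by
  simp only [← ENNReal.tsum_mul_left, ← ENNReal.tsum_mul_right]
  rw [ENNReal.tsum_comm, ← ENNReal.tsum_prod (f := fun i j => f i * g j),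
    ← HasAntidiagonal.sigmaAntidiagonalEquivProd.tsum_eq, ENNReal.tsum_sigma']
  refine tsum_congr fun n => ?_
  rw [tsum_fintype, ← sum_coe_sort]
  rfl

theorem tsum_sum_antidiagonal_mul_mul_natCast (f g : ℕ → ℝ≥0∞) :
    ∑' n : ℕ, (∑ x ∈ antidiagonal n, f x.1 * g x.2) * n
      = (∑' n, f n) * (∑' n : ℕ, g n * n) + (∑' n, g n) * ∑' n : ℕ, f n * n := by
  rw [mul_comm (∑' n, g n), ← tsum_sum_antidiagonal_mul, ← tsum_sum_antidiagonal_mul,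
    ← ENNReal.tsum_add]
  refine tsum_congr fun n => ?_
  rw [sum_mul, ← sum_add_distrib]
  refine sum_congr rfl fun x hx => ?_
  rw [← mem_antidiagonal.mp hx]
  push_cast
  ring

end Convolution

section Matrix

open Matrix

variable {ι : Type*} [Fintype ι] {A : Matrix ι ι ℝ}

theorem mulVec_le_of_mulVec_add_eq {v w : ι → ℝ} {c : ℝ} (hc : 0 < c) (hA : A *ᵥ w + v = w)
    (hw : ∀ i, w i ≤ c * v i) (i : ι) : (A *ᵥ w) i ≤ (1 - c⁻¹) * w i := by
  have hi : (A *ᵥ w) i + v i = w i := congrFun hA i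
  have hle : c⁻¹ * w i ≤ v i := (inv_mul_le_iff₀ hc).mpr (hw i)
  linarith

theorem exists_sum_abs_eq_one_of_mulVec_le [Nonempty ι] {w : ι → ℝ} (hw : ∀ i, 0 < w i) {c : ℝ}
    (hA : ∀ i, (A *ᵥ w) i ≤ c * w i) :
    ∃ v : ι → ℝ, (∀ i, 0 < v i) ∧ ∑ i, |v i| = 1 ∧ (∀ i, (A *ᵥ v) i ≤ c * v i) ∧
      ∀ i, v i = w i / ∑ j, w j := by
  have hsum : 0 < ∑ j, w j := Finset.sum_pos (fun j _ => hw j) Finset.univ_nonempty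
  have hpos : ∀ i, 0 < w i / ∑ j, w j := fun i => div_pos (hw i) hsum
  refine ⟨fun i => w i / ∑ j, w j, hpos, ?_, fun i => ?_, fun i => rfl⟩
  · simp only [abs_of_pos (hpos _), ← Finset.sum_div, div_self hsum.ne']
  · have hv : (fun i => w i / ∑ j, w j) = (∑ j, w j)⁻¹ • w :=
      funext fun i => div_eq_inv_mul _ _
    rw [hv, mulVec_smul, Pi.smul_apply, Pi.smul_apply, smul_eq_mul, smul_eq_mul, mul_left_comm]
    exact mul_le_mul_of_nonneg_left (hA i) (inv_nonneg.mpr hsum.le)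

theorem norm_le_of_mulVec_eq_smul (hA : ∀ i j, 0 ≤ A i j) {v : ι → ℝ} (hv : ∀ i, 0 < v i) {c : ℝ}
    (hAv : ∀ i, (A *ᵥ v) i ≤ c * v i) {k : ℂ} {x : ι → ℂ} (hx : x ≠ 0)
    (hk : A.map (algebraMap ℝ ℂ) *ᵥ x = k • x) : ‖k‖ ≤ c := by
  obtain ⟨i₀, hi₀⟩ : ∃ i, x i ≠ 0 := Function.ne_iff.mp hx
  obtain ⟨i, -, hi⟩ := Finset.exists_max_image Finset.univ (fun i => ‖x i‖ / v i)
    ⟨i₀, Finset.mem_univ _⟩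
  set t := ‖x i‖ / v i with ht
  have ht_pos : 0 < t :=
    (div_pos (norm_pos_iff.mpr hi₀) (hv i₀)).trans_le (hi i₀ (Finset.mem_univ _))
  have hx_le : ∀ j, ‖x j‖ ≤ t * v j := fun j => (div_le_iff₀ (hv j)).mp (hi j (Finset.mem_univ _))
  have hx_eq : ‖x i‖ = t * v i := by rw [ht, div_mul_cancel₀ _ (hv i).ne']
  refine le_of_mul_le_mul_right ?_ (mul_pos ht_pos (hv i))
  calc ‖k‖ * (t * v i) = ‖∑ j, (A i j : ℂ) * x j‖ := by
        rw [← hx_eq, ← norm_mul]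
        exact congrArg norm (congrFun hk i).symm
    _ ≤ ∑ j, A i j * (t * v j) := by
        refine norm_sum_le_of_le _ fun j _ => ?_
        rw [norm_mul, Complex.norm_real, Real.norm_of_nonneg (hA i j)]
        exact mul_le_mul_of_nonneg_left (hx_le j) (hA i j)
    _ = t * (A *ᵥ v) i := by
        simp only [mulVec, dotProduct, Finset.mul_sum, mul_left_comm]
    _ ≤ c * (t * v i) := by
        rw [mul_left_comm]
        exact mul_le_mul_of_nonneg_left (hAv i) ht_pos.le

variable [DecidableEq ι]

theorem specRad_le_of_mulVec_le (hA : ∀ i j, 0 ≤ A i j) {v : ι → ℝ} (hv : ∀ i, 0 < v i) {c : ℝ}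
    (hAv : ∀ i, (A *ᵥ v) i ≤ c * v i) : specRad A ≤ ENNReal.ofReal c := by
  refine iSup₂_le fun k hk => ?_
  rw [← Matrix.spectrum_toLin', ← Module.End.hasEigenvalue_iff_mem_spectrum] at hk
  obtain ⟨x, hx⟩ := hk.exists_hasEigenvector
  rw [← enorm_eq_nnnorm, ← ofReal_norm]
  exact ENNReal.ofReal_le_ofReal (norm_le_of_mulVec_eq_smul hA hv hAv hx.2 hx.apply_eq_smul)

theorem ofReal_le_specRad_of_mulVec_eq_smul {v : ι → ℝ} (hv : v ≠ 0) {c : ℝ}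
    (hAv : A *ᵥ v = c • v) : ENNReal.ofReal c ≤ specRad A := by
  have hmem : (c : ℂ) ∈ spectrum ℂ (A.map (algebraMap ℝ ℂ)) := by
    rw [← Matrix.spectrum_toLin', ← Module.End.hasEigenvalue_iff_mem_spectrum]
    refine Module.End.hasEigenvalue_of_hasEigenvector (x := algebraMap ℝ ℂ ∘ v)
      (Module.End.hasEigenvector_iff.mpr ⟨Module.End.mem_eigenspace_iff.mpr ?_, ?_⟩)
    · ext i
      rw [Matrix.toLin'_apply, ← RingHom.map_mulVec, hAv]
      simp
    · simpa [funext_iff] using hv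
  refine le_trans ?_ (le_iSup₂_of_le (c : ℂ) hmem le_rfl)
  rw [← enorm_eq_nnnorm, ← ofReal_norm, Complex.norm_real]
  exact ENNReal.ofReal_le_ofReal (Real.le_norm_self c)

end Matrix

namespace PPS

open MvPolynomial Matrix

variable {J : Type*}

/-- The formal directional derivative along `e`, which turns products of a Jacobi matrix with a
vector into a computation by the Leibniz rule. -/
noncomputable def directionalDeriv (e : J → ℝ≥0) :
    Derivation ℝ≥0 (MvPolynomial J ℝ≥0) (MvPolynomial J ℝ≥0) :=
  mkDerivation ℝ≥0 fun j => C (e j)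

theorem directionalDeriv_X (e : J → ℝ≥0) (j : J) : directionalDeriv e (X j) = C (e j) :=
  mkDerivation_X ℝ≥0 _ j

theorem directionalDeriv_apply [Fintype J] (e : J → ℝ≥0) (P : MvPolynomial J ℝ≥0) :
    directionalDeriv e P = ∑ j, C (e j) * pderiv j P := by
  classical
  induction P using MvPolynomial.induction_on with
  | C a => simp
  | add P P' hP hP' => simp only [map_add, hP, hP', mul_add, Finset.sum_add_distrib]
  | mul_X P k hP =>
    simp [hP, directionalDeriv_X, pderiv_X, Pi.single_apply, Finset.mul_sum, mul_add,
      Finset.sum_add_distrib, mul_comm, mul_left_comm]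

theorem jacobi_mulVec [Fintype J] (f : PPS J) (u e : J → ℝ≥0) (i : J) :
    (f.jacobi u *ᵥ fun j => (e j : ℝ)) i = eval u (directionalDeriv e (f i)) := by
  simp [directionalDeriv_apply, jacobi, mulVec, dotProduct, mul_comm]

theorem jacobiLfp_nonneg (f : PPS J) (i j : J) : 0 ≤ f.jacobiLfp i j :=
  NNReal.coe_nonneg _

theorem toFun_lfp (f : PPS J) : f.toFun f.lfp = f.lfp :=
  OrderHom.map_lfp f.toFun

theorem lfp_eq_zero_or_exists_val_eq (f : PPS J) (j : J) :
    f.lfp j = 0 ∨ ∃ i : f.CleanIndex, i.1 = j :=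
  or_iff_not_imp_left.mpr fun hj => ⟨⟨j, hj⟩, rfl⟩

open Classical in
/-- The extension of a vector by zero to the variables removed by cleaning up. -/
noncomputable def extendZero {R : Type*} [Zero R] (f : PPS J) (u : f.CleanIndex → R) (j : J) : R :=
  if h : f.lfp j ≠ 0 then u ⟨j, h⟩ else 0

theorem extendZero_val {R : Type*} [Zero R] (f : PPS J) (u : f.CleanIndex → R) (i : f.CleanIndex) :
    f.extendZero u i.1 = u i :=
  dif_pos i.2

theorem extendZero_of_lfp_eq_zero {R : Type*} [Zero R] (f : PPS J) (u : f.CleanIndex → R) {j : J}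
    (hj : f.lfp j = 0) : f.extendZero u j = 0 :=
  dif_neg (not_not.mpr hj)

theorem extendZero_comp_val {R : Type*} [Zero R] (f : PPS J) {u : J → R}
    (hu : ∀ j, f.lfp j = 0 → u j = 0) : f.extendZero (fun i => u i.1) = u := by
  funext j
  by_cases hj : f.lfp j = 0
  · rw [extendZero_of_lfp_eq_zero f _ hj, hu j hj]
  · exact dif_pos hj

theorem clean_toFun (f : PPS J) (u : f.CleanIndex → ℝ≥0∞) (i : f.CleanIndex) :
    f.clean.toFun u i = f.toFun (f.extendZero u) i.1 := by
  refine (eval₂Hom_bind₁ ENNReal.ofNNRealHom u _ (f i.1)).trans ?_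
  rw [coe_eval₂Hom]
  refine congrArg (fun g => eval₂ ENNReal.ofNNRealHom g (f i.1)) (funext fun j => ?_)
  change eval₂ ENNReal.ofNNRealHom u (f.extendZero X j) = f.extendZero u j
  obtain hj | ⟨k, rfl⟩ := f.lfp_eq_zero_or_exists_val_eq j
  · rw [extendZero_of_lfp_eq_zero f _ hj, extendZero_of_lfp_eq_zero f _ hj, eval₂_zero]
  · rw [extendZero_val, extendZero_val, eval₂_X]

theorem clean_lfp (f : PPS J) (i : f.CleanIndex) : f.clean.lfp i = f.lfp i.1 := by
  have hle : f.clean.lfp ≤ fun i => f.lfp i.1 := OrderHom.lfp_le _ fun i => by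
    rw [clean_toFun, f.extendZero_comp_val fun _ => id, toFun_lfp]
  have hext : f.extendZero f.clean.lfp ≤ f.lfp := fun j => by
    by_cases hj : f.lfp j = 0
    · rw [extendZero_of_lfp_eq_zero f _ hj]
      exact zero_le
    · exact (f.extendZero_val f.clean.lfp ⟨j, hj⟩).trans_le (hle ⟨j, hj⟩)
  have hge : f.lfp ≤ f.extendZero f.clean.lfp := OrderHom.lfp_le _ fun j => by
    by_cases hj : f.lfp j = 0
    · calc f.toFun (f.extendZero f.clean.lfp) j ≤ f.toFun f.lfp j := f.toFun.monotone hext j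
        _ = 0 := by rw [toFun_lfp, hj]
        _ ≤ _ := zero_le
    · calc f.toFun (f.extendZero f.clean.lfp) j = f.clean.toFun f.clean.lfp ⟨j, hj⟩ :=
            (f.clean_toFun f.clean.lfp ⟨j, hj⟩).symm
        _ = f.clean.lfp ⟨j, hj⟩ := by rw [toFun_lfp]
        _ ≤ _ := (f.extendZero_val f.clean.lfp ⟨j, hj⟩).ge
  exact le_antisymm (hle i) ((hge i.1).trans_eq (f.extendZero_val f.clean.lfp i))

theorem eval_bind₁_extendZero_X (f : PPS J) (u : f.CleanIndex → ℝ≥0) (P : MvPolynomial J ℝ≥0) :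
    eval u (bind₁ (f.extendZero X) P) = eval (f.extendZero u) P := by
  refine (eval₂Hom_bind₁ (RingHom.id ℝ≥0) u _ P).trans ?_
  rw [coe_eval₂Hom]
  refine congrArg (fun g => eval₂ (RingHom.id ℝ≥0) g P) (funext fun j => ?_)
  obtain hj | ⟨k, rfl⟩ := f.lfp_eq_zero_or_exists_val_eq j
  · rw [extendZero_of_lfp_eq_zero f _ hj, extendZero_of_lfp_eq_zero f _ hj, map_zero]
  · rw [extendZero_val, extendZero_val, eval₂Hom_X']

theorem pderiv_extendZero_X (f : PPS J) (i : f.CleanIndex) (j : J) :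
    pderiv i (f.extendZero (X (R := ℝ≥0)) j) = bind₁ (f.extendZero X) (pderiv i.1 (X j)) := by
  obtain hj | ⟨k, rfl⟩ := f.lfp_eq_zero_or_exists_val_eq j
  · have hne : j ≠ i.1 := fun h => i.2 (h ▸ hj)
    rw [extendZero_of_lfp_eq_zero f _ hj, pderiv_X_of_ne hne, map_zero, map_zero]
  · rw [extendZero_val]
    obtain rfl | hne := eq_or_ne k i
    · rw [pderiv_X_self, pderiv_X_self, map_one]
    · rw [pderiv_X_of_ne hne, pderiv_X_of_ne fun h => hne (Subtype.ext h), map_zero]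

theorem pderiv_bind₁_extendZero_X (f : PPS J) (i : f.CleanIndex) (P : MvPolynomial J ℝ≥0) :
    pderiv i (bind₁ (f.extendZero X) P) = bind₁ (f.extendZero X) (pderiv i.1 P) := by
  induction P using MvPolynomial.induction_on with
  | C a => simp
  | add P P' hP hP' => simp only [map_add, hP, hP']
  | mul_X P k hP =>
    simp only [map_mul, bind₁_X_right, Derivation.leibniz, smul_eq_mul, map_add, hP,
      pderiv_extendZero_X]

theorem clean_jacobi (f : PPS J) (u : f.CleanIndex → ℝ≥0) :
    f.clean.jacobi u = (f.jacobi (f.extendZero u)).submatrix Subtype.val Subtype.val := by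
  ext i j
  change ((eval u (pderiv j (bind₁ (f.extendZero X) (f i.1))) : ℝ≥0) : ℝ) = _
  rw [pderiv_bind₁_extendZero_X, eval_bind₁_extendZero_X]
  rfl

theorem clean_jacobiLfp (f : PPS J) :
    f.clean.jacobiLfp = f.jacobiLfp.submatrix Subtype.val Subtype.val := by
  have hlfp : (fun i => (f.clean.lfp i).toNNReal) = fun i : f.CleanIndex => (f.lfp i.1).toNNReal :=
    funext fun i => by rw [clean_lfp]
  have hext : f.extendZero (fun i => (f.lfp i.1).toNNReal) = fun j => (f.lfp j).toNNReal :=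
    f.extendZero_comp_val (u := fun j => (f.lfp j).toNNReal) fun j hj => by simp [hj]
  rw [jacobiLfp, hlfp, clean_jacobi, hext, jacobiLfp]

theorem clean_jacobiLfp_mulVec [Fintype J] (f : PPS J) {e : J → ℝ}
    (he : ∀ j, f.lfp j = 0 → e j = 0) (i : f.CleanIndex) :
    (f.clean.jacobiLfp *ᵥ fun j => e j.1) i = (f.jacobiLfp *ᵥ e) i.1 := by
  rw [clean_jacobiLfp]
  refine Fintype.sum_of_injective (fun j : f.CleanIndex => j.1) Subtype.val_injective _ _
    (fun j hj => ?_) fun _ => rfl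
  have : f.lfp j = 0 := by_contra fun h => hj ⟨⟨j, h⟩, rfl⟩
  rw [he j this, mul_zero]

end PPS

namespace WeightedPDA

open Finset.HasAntidiagonal (antidiagonal)

variable {Q Γ : Type*}

/-- The right-hand sides of transitions: a state together with a word of length at most two. -/
abbrev Move (Q Γ : Type*) := Q × Option (Γ × Option Γ)

/-- The word that a transition puts on the stack. -/
def Move.word (m : Move Q Γ) : List Γ :=
  match m.2 with
  | none => []
  | some (Y, none) => [Y]
  | some (Y, some X) => [Y, X]

/-- The weight of a transition, uniformly in the length of the word that it pushes. -/
def moveWeight (Δ : WeightedPDA Q Γ) (p : Q) (Z : Γ) (m : Move Q Γ) : ℝ≥0 :=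
  match m.2 with
  | none => Δ.pop p Z m.1
  | some (Y, none) => Δ.swap p Z m.1 Y
  | some (Y, some X) => Δ.push p Z m.1 Y X

theorem tsum_ite_eq_mul {A : Type*} [DecidableEq A] (b : A) (c : ℝ≥0) (F : A → ℝ≥0∞) :
    ∑' a, ((if a = b then c else 0 : ℝ≥0) : ℝ≥0∞) * F a = c * F b := by
  rw [tsum_eq_single b]
  · simp
  · intro a ha
    simp [ha]

variable [Fintype Γ]

section

variable [DecidableEq Γ]

theorem transMatrix_nil (Δ : WeightedPDA Q Γ) (p : Q) (s : Q × List Γ) :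
    Δ.transMatrix (p, []) s = 0 := by
  simp [transMatrix]

theorem hitWeight_zero_cons (Δ : WeightedPDA Q Γ) (p : Q) (Z : Γ) (β : List Γ) (q : Q) :
    hitWeight Δ.transMatrix {(q, [])} 0 (p, Z :: β) = 0 :=
  hitWeight_zero_of_notMem _ (by simp)

theorem hitWeight_succ_nil (Δ : WeightedPDA Q Γ) (n : ℕ) (p q : Q) :
    hitWeight Δ.transMatrix {(q, [])} (n + 1) (p, []) = 0 := by
  by_cases h : (p, ([] : List Γ)) ∈ ({(q, [])} : Set (Q × List Γ))
  · exact hitWeight_succ_of_mem _ n h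
  · simp [hitWeight_succ_of_notMem _ n h, transMatrix_nil]

theorem sum_antidiagonal_hitWeight_nil [DecidableEq Q] (Δ : WeightedPDA Q Γ) (n : ℕ) (p t : Q)
    (F : ℕ → ℝ≥0∞) :
    ∑ x ∈ antidiagonal n, hitWeight Δ.transMatrix {(t, [])} x.1 (p, []) * F x.2
      = if p = t then F n else 0 := by
  have hzero : hitWeight Δ.transMatrix {(t, [])} 0 (p, []) = if p = t then 1 else 0 := by
    split_ifs with h
    · exact hitWeight_zero_of_mem _ (by simp [h])
    · exact hitWeight_zero_of_notMem _ (by simp [h])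
  cases n <;> simp [Finset.Nat.sum_antidiagonal_succ, hzero, hitWeight_succ_nil]

/-- The `k`-th moment of the number of steps of the runs from `pα` to `qε`, which extends
`returnProb` and `firstMoment` to arbitrary stack contents `α`. -/
noncomputable def runMoment (Δ : WeightedPDA Q Γ) (k : ℕ) (p : Q) (α : List Γ) (q : Q) : ℝ≥0∞ :=
  terminationMoment Δ.transMatrix k (p, α) {(q, [])}

theorem runMoment_zero_singleton (Δ : WeightedPDA Q Γ) (p : Q) (Z : Γ) (q : Q) :
    Δ.runMoment 0 p [Z] q = Δ.returnProb p Z q :=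
  rfl

theorem runMoment_one_singleton (Δ : WeightedPDA Q Γ) (p : Q) (Z : Γ) (q : Q) :
    Δ.runMoment 1 p [Z] q = Δ.firstMoment p Z q :=
  rfl

theorem runMoment_zero_nil [DecidableEq Q] (Δ : WeightedPDA Q Γ) (p q : Q) :
    Δ.runMoment 0 p [] q = if p = q then 1 else 0 := by
  split_ifs with h
  · exact terminationMoment_zero_of_mem _ (by simp [h])
  · rw [runMoment, terminationMoment_zero_of_notMem _ (by simp [h])]
    simp [transMatrix_nil]

theorem runMoment_one_nil (Δ : WeightedPDA Q Γ) (p q : Q) : Δ.runMoment 1 p [] q = 0 := by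
  by_cases h : p = q
  · exact terminationMoment_one_of_mem _ (by simp [h])
  · classical
    exact terminationMoment_one_eq_zero ((Δ.runMoment_zero_nil p q).trans (if_neg h))

end

variable [Fintype Q]

theorem sum_move {A : Type*} [AddCommMonoid A] (F : Move Q Γ → A) :
    ∑ m, F m = (∑ r, F (r, none)) + (∑ r, ∑ Y, F (r, some (Y, none)))
      + ∑ r, ∑ Y, ∑ X, F (r, some (Y, some X)) := by
  simp only [Fintype.sum_prod_type, Fintype.sum_option, Finset.sum_add_distrib, add_assoc]

theorem IsProbabilistic.sum_moveWeight {Δ : WeightedPDA Q Γ} (hΔ : Δ.IsProbabilistic) (p : Q)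
    (Z : Γ) : ∑ m, Δ.moveWeight p Z m = 1 := by
  rw [sum_move]
  simp only [moveWeight]
  exact_mod_cast congrArg (NNRat.cast : ℚ≥0 → ℝ≥0) (hΔ p Z)

variable [DecidableEq Γ]

theorem tsum_transMatrix_mul (Δ : WeightedPDA Q Γ) (p : Q) (Z : Γ) (β : List Γ)
    (F : Q × List Γ → ℝ≥0∞) :
    ∑' t, (Δ.transMatrix (p, Z :: β) t : ℝ≥0∞) * F t
      = ∑ m : Move Q Γ, (Δ.moveWeight p Z m : ℝ≥0∞) * F (m.1, m.word ++ β) := by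
  rw [ENNReal.tsum_prod', tsum_fintype, sum_move, ← Finset.sum_add_distrib,
    ← Finset.sum_add_distrib]
  refine Finset.sum_congr rfl fun r _ => ?_
  have h : ∀ γ, (Δ.transMatrix (p, Z :: β) (r, γ) : ℝ≥0∞) * F (r, γ)
      = ((if γ = β then (Δ.pop p Z r : ℝ≥0) else 0 : ℝ≥0) : ℝ≥0∞) * F (r, γ)
        + (∑ Y, ((if γ = Y :: β then (Δ.swap p Z r Y : ℝ≥0) else 0 : ℝ≥0) : ℝ≥0∞) * F (r, γ))
        + ∑ Y, ∑ X, ((if γ = Y :: X :: β then (Δ.push p Z r Y X : ℝ≥0) else 0 : ℝ≥0) : ℝ≥0∞)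
          * F (r, γ) := fun γ => by
    simp only [transMatrix, NNRat.cast_add, NNRat.cast_sum, ENNReal.coe_add,
      ENNReal.ofNNReal_finsetSum, add_mul, Finset.sum_mul, apply_ite (NNRat.cast : ℚ≥0 → ℝ≥0),
      NNRat.cast_zero]
  simp only [h, ENNReal.tsum_add, Summable.tsum_finsetSum fun _ _ => ENNReal.summable,
    tsum_ite_eq_mul]
  rfl

theorem IsProbabilistic.tsum_transMatrix_le_one {Δ : WeightedPDA Q Γ} (hΔ : Δ.IsProbabilistic) :
    ∀ s, ∑' t, (Δ.transMatrix s t : ℝ≥0∞) ≤ 1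
  | (p, []) => by simp [transMatrix_nil]
  | (p, Z :: β) => by
    have h := Δ.tsum_transMatrix_mul p Z β fun _ => 1
    simp only [mul_one] at h
    rw [h, ← ENNReal.ofNNReal_finsetSum, hΔ.sum_moveWeight, ENNReal.coe_one]

theorem hitWeight_succ_cons (Δ : WeightedPDA Q Γ) (n : ℕ) (p : Q) (Z : Γ) (β : List Γ) (q : Q) :
    hitWeight Δ.transMatrix {(q, [])} (n + 1) (p, Z :: β)
      = ∑ m : Move Q Γ, (Δ.moveWeight p Z m : ℝ≥0∞)
          * hitWeight Δ.transMatrix {(q, [])} n (m.1, m.word ++ β) := by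
  rw [hitWeight_succ_of_notMem _ _ (by simp), tsum_transMatrix_mul]

-- A run that empties the stack `αβ` first empties `α` and then, from the state so reached, `β`.
theorem hitWeight_append (Δ : WeightedPDA Q Γ) (n : ℕ) (p : Q) (α β : List Γ) (q : Q) :
    hitWeight Δ.transMatrix {(q, [])} n (p, α ++ β)
      = ∑ t, ∑ x ∈ antidiagonal n, hitWeight Δ.transMatrix {(t, [])} x.1 (p, α)
          * hitWeight Δ.transMatrix {(q, [])} x.2 (t, β) := by
  classical
  have hnil (n : ℕ) (p : Q) : hitWeight Δ.transMatrix {(q, [])} n (p, [] ++ β)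
      = ∑ t, ∑ x ∈ antidiagonal n,
          hitWeight Δ.transMatrix {(t, [])} x.1 (p, [])
            * hitWeight Δ.transMatrix {(q, [])} x.2 (t, β) := by
    refine Eq.trans ?_ (Finset.sum_congr rfl fun t _ =>
      (Δ.sum_antidiagonal_hitWeight_nil n p t (hitWeight _ _ · (t, β))).symm)
    simp
  induction n generalizing p α with
  | zero =>
    cases α with
    | nil => exact hnil 0 p
    | cons Z α => simp [hitWeight_zero_cons]
  | succ n ih =>
    cases α with
    | nil => exact hnil (n + 1) p
    | cons Z α =>
      simp only [List.cons_append, hitWeight_succ_cons, Finset.Nat.sum_antidiagonal_succ,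
        hitWeight_zero_cons, zero_mul, zero_add, ← List.append_assoc, ih, Finset.mul_sum,
        Finset.sum_mul, mul_assoc]
      rw [Finset.sum_comm]
      exact Finset.sum_congr rfl fun t _ => Finset.sum_comm

theorem runMoment_zero_cons (Δ : WeightedPDA Q Γ) (p : Q) (Z : Γ) (β : List Γ) (q : Q) :
    Δ.runMoment 0 p (Z :: β) q
      = ∑ m : Move Q Γ, (Δ.moveWeight p Z m : ℝ≥0∞) * Δ.runMoment 0 m.1 (m.word ++ β) q := by
  rw [runMoment, terminationMoment_zero_of_notMem _ (by simp), tsum_transMatrix_mul]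
  rfl

theorem runMoment_one_cons (Δ : WeightedPDA Q Γ) (p : Q) (Z : Γ) (β : List Γ) (q : Q) :
    Δ.runMoment 1 p (Z :: β) q = Δ.runMoment 0 p (Z :: β) q
      + ∑ m : Move Q Γ, (Δ.moveWeight p Z m : ℝ≥0∞) * Δ.runMoment 1 m.1 (m.word ++ β) q := by
  rw [runMoment, terminationMoment_one_of_notMem _ (by simp), tsum_transMatrix_mul]
  rfl

theorem runMoment_zero_append (Δ : WeightedPDA Q Γ) (p : Q) (α β : List Γ) (q : Q) :
    Δ.runMoment 0 p (α ++ β) q = ∑ t, Δ.runMoment 0 p α t * Δ.runMoment 0 t β q := by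
  simp only [runMoment, terminationMoment_zero_eq_tsum, hitWeight_append,
    Summable.tsum_finsetSum fun _ _ => ENNReal.summable, ← tsum_sum_antidiagonal_mul]

theorem runMoment_one_append (Δ : WeightedPDA Q Γ) (p : Q) (α β : List Γ) (q : Q) :
    Δ.runMoment 1 p (α ++ β) q = ∑ t, (Δ.runMoment 0 p α t * Δ.runMoment 1 t β q
      + Δ.runMoment 0 t β q * Δ.runMoment 1 p α t) := by
  simp only [runMoment, terminationMoment_zero_eq_tsum, terminationMoment_one_eq_tsum,
    hitWeight_append, ← tsum_sum_antidiagonal_mul_mul_natCast]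
  rw [← Summable.tsum_finsetSum fun _ _ => ENNReal.summable]
  simp only [Finset.sum_mul]

end WeightedPDA

namespace WeightedPDA

open Matrix

variable {Q Γ : Type*} [Fintype Q]

open Classical in
/-- The extension of a vector indexed by triples `pZq` to all stack contents, multiplicative under
concatenation; the return probabilities of words arise from those of letters in this way. -/
noncomputable def wordExt (u : Q × Γ × Q → ℝ≥0∞) : Q → List Γ → Q → ℝ≥0∞
  | p, [], q => if p = q then 1 else 0
  | p, Z :: β, q => ∑ t, u (p, Z, t) * wordExt u t β q

theorem wordExt_append (u : Q × Γ × Q → ℝ≥0∞) (p : Q) (α β : List Γ) (q : Q) :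
    wordExt u p (α ++ β) q = ∑ t, wordExt u p α t * wordExt u t β q := by
  classical
  induction α generalizing p with
  | nil => simp [wordExt]
  | cons Z α ih =>
    simp only [List.cons_append, wordExt, ih, Finset.mul_sum, Finset.sum_mul, ← mul_assoc]
    exact Finset.sum_comm

theorem wordExt_singleton (u : Q × Γ × Q → ℝ≥0∞) (p : Q) (Z : Γ) (q : Q) :
    wordExt u p [Z] q = u (p, Z, q) := by
  classical
  simp [wordExt]

variable [Fintype Γ] (Δ : WeightedPDA Q Γ)

theorem fundamentalPPS_toFun (u : Q × Γ × Q → ℝ≥0∞) (p : Q) (Z : Γ) (q : Q) :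
    Δ.fundamentalPPS.toFun u (p, Z, q)
      = ((Δ.pop p Z q : ℝ≥0) : ℝ≥0∞)
        + (∑ r, ∑ Y, ((Δ.swap p Z r Y : ℝ≥0) : ℝ≥0∞) * u (r, Y, q))
        + ∑ r, ∑ Y, ∑ X, ((Δ.push p Z r Y X : ℝ≥0) : ℝ≥0∞)
          * ∑ t, u (r, Y, t) * u (t, X, q) := by
  change (Δ.fundamentalPPS (p, Z, q)).eval₂ ENNReal.ofNNRealHom u = _
  simp only [fundamentalPPS, MvPolynomial.eval₂_add, MvPolynomial.eval₂_sum, MvPolynomial.eval₂_mul,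
    MvPolynomial.eval₂_C, MvPolynomial.eval₂_X]
  rfl

theorem sum_moveWeight_mul_wordExt (u : Q × Γ × Q → ℝ≥0∞) (p : Q) (Z : Γ) (q : Q) :
    ∑ m : Move Q Γ, (Δ.moveWeight p Z m : ℝ≥0∞) * wordExt u m.1 m.word q
      = Δ.fundamentalPPS.toFun u (p, Z, q) := by
  classical
  rw [sum_move, fundamentalPPS_toFun]
  simp [moveWeight, Move.word, wordExt]

theorem eval_directionalDeriv_fundamentalPPS (u e : Q × Γ × Q → ℝ≥0) (p : Q) (Z : Γ) (q : Q) :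
    MvPolynomial.eval u (PPS.directionalDeriv e (Δ.fundamentalPPS (p, Z, q)))
      = (∑ r, ∑ Y, (Δ.swap p Z r Y : ℝ≥0) * e (r, Y, q))
        + ∑ r, ∑ Y, ∑ X, (Δ.push p Z r Y X : ℝ≥0)
          * ∑ t, (u (r, Y, t) * e (t, X, q) + u (t, X, q) * e (r, Y, t)) := by
  simp [fundamentalPPS, PPS.directionalDeriv_X]

variable [DecidableEq Γ]

theorem runMoment_zero_le_wordExt {u : Q × Γ × Q → ℝ≥0∞} (hu : Δ.fundamentalPPS.toFun u ≤ u)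
    (p : Q) (α : List Γ) (q : Q) : Δ.runMoment 0 p α q ≤ wordExt u p α q := by
  refine terminationMoment_zero_le_of_superharmonic (h := fun s => wordExt u s.1 s.2 q) ?_ ?_ (p, α)
  · rintro s rfl
    simp [wordExt]
  rintro ⟨p, _ | ⟨Z, β⟩⟩ -
  · simp [transMatrix_nil]
  calc ∑' t, (Δ.transMatrix (p, Z :: β) t : ℝ≥0∞) * wordExt u t.1 t.2 q
      = ∑ m : Move Q Γ, (Δ.moveWeight p Z m : ℝ≥0∞) * wordExt u m.1 (m.word ++ β) q :=
        Δ.tsum_transMatrix_mul p Z β fun t => wordExt u t.1 t.2 q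
    _ = ∑ t, Δ.fundamentalPPS.toFun u (p, Z, t) * wordExt u t β q := by
        simp only [← sum_moveWeight_mul_wordExt, wordExt_append, Finset.mul_sum, Finset.sum_mul,
          ← mul_assoc]
        exact Finset.sum_comm
    _ ≤ wordExt u p (Z :: β) q := Finset.sum_le_sum fun t _ => mul_le_mul_left (hu _) _

theorem runMoment_zero_eq_wordExt (p : Q) (α : List Γ) (q : Q) :
    Δ.runMoment 0 p α q = wordExt (fun j => Δ.returnProb j.1 j.2.1 j.2.2) p α q := by
  classical
  induction α generalizing p with
  | nil => rw [runMoment_zero_nil, wordExt]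
  | cons Z β ih =>
    rw [← List.singleton_append, runMoment_zero_append]
    simp only [List.singleton_append, wordExt, runMoment_zero_singleton, ih]

theorem returnProb_eq_toFun (p : Q) (Z : Γ) (q : Q) :
    Δ.returnProb p Z q
      = Δ.fundamentalPPS.toFun (fun j => Δ.returnProb j.1 j.2.1 j.2.2) (p, Z, q) := by
  rw [← sum_moveWeight_mul_wordExt, ← runMoment_zero_singleton, runMoment_zero_cons]
  simp only [List.append_nil, runMoment_zero_eq_wordExt]

theorem fundamentalPPS_lfp (p : Q) (Z : Γ) (q : Q) :
    Δ.fundamentalPPS.lfp (p, Z, q) = Δ.returnProb p Z q := by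
  refine le_antisymm ?_ ?_
  · exact OrderHom.lfp_le Δ.fundamentalPPS.toFun (a := fun j => Δ.returnProb j.1 j.2.1 j.2.2)
      (fun j => (Δ.returnProb_eq_toFun j.1 j.2.1 j.2.2).ge) (p, Z, q)
  · rw [← wordExt_singleton Δ.fundamentalPPS.lfp]
    exact Δ.runMoment_zero_le_wordExt Δ.fundamentalPPS.toFun_lfp.le p [Z] q

theorem firstMoment_eq_returnProb_add (p : Q) (Z : Γ) (q : Q) :
    Δ.firstMoment p Z q = Δ.returnProb p Z q
      + ((∑ r, ∑ Y, ((Δ.swap p Z r Y : ℝ≥0) : ℝ≥0∞) * Δ.firstMoment r Y q)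
        + ∑ r, ∑ Y, ∑ X, ((Δ.push p Z r Y X : ℝ≥0) : ℝ≥0∞)
          * ∑ t, (Δ.returnProb r Y t * Δ.firstMoment t X q
            + Δ.returnProb t X q * Δ.firstMoment r Y t)) := by
  rw [← runMoment_one_singleton, runMoment_one_cons, sum_move]
  simp only [moveWeight, Move.word, List.append_nil, runMoment_one_nil, mul_zero,
    Finset.sum_const_zero, zero_add, ← runMoment_one_append, List.singleton_append,
    ← runMoment_one_singleton, ← runMoment_zero_singleton]

end WeightedPDA

theorem iSup_lt_top_of_finite {ι : Sort*} [Finite ι] {f : ι → ℝ≥0∞} (hf : ∀ i, f i < ⊤) :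
    ⨆ i, f i < ⊤ := by
  cases isEmpty_or_nonempty ι
  · simp
  · obtain ⟨i, hi⟩ := exists_eq_ciSup_of_finite (f := fun i : PLift ι => f i.down)
    exact (hi.trans (iSup_plift_down f)) ▸ hf i.down

namespace WeightedPDA

open Matrix

variable {Q Γ : Type*} [Fintype Γ] [DecidableEq Γ] {Δ : WeightedPDA Q Γ}

theorem condRuntime_le_maxCondRuntime {p : Q} {Z : Γ} {q : Q} (h : 0 < Δ.returnProb p Z q) :
    Δ.condRuntime p Z q ≤ Δ.maxCondRuntime :=
  le_iSup_of_le p <| le_iSup_of_le Z <| le_iSup_of_le q <| le_iSup_of_le h le_rfl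

theorem minReturnProb_le_returnProb {p : Q} {Z : Γ} {q : Q} (h : 0 < Δ.returnProb p Z q) :
    Δ.minReturnProb ≤ Δ.returnProb p Z q :=
  iInf_le_of_le p <| iInf_le_of_le Z <| iInf_le_of_le q <| iInf_le_of_le h le_rfl

theorem IsCPAST.maxCondRuntime_lt_top [Finite Q] (hc : Δ.IsCPAST) : Δ.maxCondRuntime < ⊤ :=
  iSup_lt_top_of_finite fun p => iSup_lt_top_of_finite fun Z => iSup_lt_top_of_finite fun q =>
    iSup_lt_top_of_finite fun h => hc p Z q h

theorem returnProb_le_firstMoment (p : Q) (Z : Γ) (q : Q) :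
    Δ.returnProb p Z q ≤ Δ.firstMoment p Z q :=
  terminationMoment_zero_le_terminationMoment_one _ (by simp)

/-- The return probabilities as a real vector. -/
noncomputable def returnVec (Δ : WeightedPDA Q Γ) (j : Q × Γ × Q) : ℝ :=
  (Δ.returnProb j.1 j.2.1 j.2.2).toReal

/-- The first moments as a real vector. -/
noncomputable def momentVec (Δ : WeightedPDA Q Γ) (j : Q × Γ × Q) : ℝ :=
  (Δ.firstMoment j.1 j.2.1 j.2.2).toReal

section

variable [Fintype Q]

theorem lfp_eq_zero_iff {j : Q × Γ × Q} :
    Δ.fundamentalPPS.lfp j = 0 ↔ Δ.returnProb j.1 j.2.1 j.2.2 = 0 :=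
  (Δ.fundamentalPPS_lfp j.1 j.2.1 j.2.2).congr_left

theorem returnProb_pos (j : Δ.fundamentalPPS.CleanIndex) :
    0 < Δ.returnProb j.1.1 j.1.2.1 j.1.2.2 :=
  pos_iff_ne_zero.mpr fun h => j.2 (lfp_eq_zero_iff.mpr h)

theorem nonempty_cleanIndex (hpos : ∃ p Z q, 0 < Δ.returnProb p Z q) :
    Nonempty Δ.fundamentalPPS.CleanIndex :=
  let ⟨p, Z, q, h⟩ := hpos
  ⟨⟨(p, Z, q), lfp_eq_zero_iff.not.mpr h.ne'⟩⟩

theorem sum_cleanIndex_returnVec :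
    ∑ j : Δ.fundamentalPPS.CleanIndex, Δ.returnVec j.1 = ∑ j : Q × Γ × Q, Δ.returnVec j := by
  refine Fintype.sum_of_injective (fun j : Δ.fundamentalPPS.CleanIndex => j.1)
    Subtype.val_injective _ _ (fun j hj => ?_) fun _ => rfl
  have hlfp : Δ.fundamentalPPS.lfp j = 0 := not_not.mp fun h => hj ⟨⟨j, h⟩, rfl⟩
  rw [returnVec, lfp_eq_zero_iff.mp hlfp, ENNReal.toReal_zero]

theorem sum_returnVec_le {B : ℝ≥0} (hB : ∑ j : Q × Γ × Q, Δ.returnProb j.1 j.2.1 j.2.2 ≤ B) :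
    ∑ j : Q × Γ × Q, Δ.returnVec j ≤ B := by
  have hfin := ENNReal.sum_ne_top.mp (ne_top_of_le_ne_top ENNReal.coe_ne_top hB)
  simp only [returnVec]
  rw [← ENNReal.toReal_sum hfin, ← ENNReal.coe_toReal]
  exact ENNReal.toReal_mono ENNReal.coe_ne_top hB

end

section Finite

variable (hfin : ∀ p Z q, Δ.returnProb p Z q ≠ ⊤)
include hfin

theorem IsCPAST.firstMoment_ne_top (hc : Δ.IsCPAST) (p : Q) (Z : Γ) (q : Q) :
    Δ.firstMoment p Z q ≠ ⊤ := by
  intro htop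
  rcases eq_or_ne (Δ.returnProb p Z q) 0 with h | h
  · exact ENNReal.zero_ne_top ((terminationMoment_one_eq_zero h).symm.trans htop)
  · refine (hc p Z q (pos_iff_ne_zero.mpr h)).ne ?_
    rw [condRuntime, htop, ENNReal.top_div_of_ne_top (hfin p Z q)]

theorem one_le_condRuntime {p : Q} {Z : Γ} {q : Q} (h : 0 < Δ.returnProb p Z q) :
    1 ≤ Δ.condRuntime p Z q := by
  rw [condRuntime, ENNReal.le_div_iff_mul_le (Or.inl h.ne') (Or.inl (hfin p Z q)), one_mul]
  exact returnProb_le_firstMoment p Z q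

theorem one_le_maxCondRuntime (hpos : ∃ p Z q, 0 < Δ.returnProb p Z q) :
    1 ≤ Δ.maxCondRuntime := by
  obtain ⟨p, Z, q, h⟩ := hpos
  exact (one_le_condRuntime hfin h).trans (condRuntime_le_maxCondRuntime h)

theorem maxCondRuntime_toReal_pos [Finite Q] (hc : Δ.IsCPAST)
    (hpos : ∃ p Z q, 0 < Δ.returnProb p Z q) : 0 < Δ.maxCondRuntime.toReal :=
  ENNReal.toReal_pos (one_pos.trans_le (one_le_maxCondRuntime hfin hpos)).ne'
    hc.maxCondRuntime_lt_top.ne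

theorem condRuntime_mul_returnProb (p : Q) (Z : Γ) (q : Q) :
    Δ.condRuntime p Z q * Δ.returnProb p Z q = Δ.firstMoment p Z q :=
  ENNReal.div_mul_cancel' terminationMoment_one_eq_zero fun h => absurd h (hfin p Z q)

variable [Fintype Q]

theorem returnVec_pos (j : Δ.fundamentalPPS.CleanIndex) : 0 < Δ.returnVec j.1 :=
  ENNReal.toReal_pos (returnProb_pos j).ne' (hfin _ _ _)

variable (hc : Δ.IsCPAST)
include hc

theorem jacobiLfp_mulVec_momentVec_add :
    Δ.fundamentalPPS.jacobiLfp *ᵥ Δ.momentVec + Δ.returnVec = Δ.momentVec := by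
  obtain ⟨μ, hμ⟩ : ∃ μ : Q × Γ × Q → ℝ≥0, ∀ p Z q, Δ.returnProb p Z q = μ (p, Z, q) :=
    ⟨fun j => (Δ.returnProb j.1 j.2.1 j.2.2).toNNReal,
      fun p Z q => (ENNReal.coe_toNNReal (hfin p Z q)).symm⟩
  obtain ⟨e, he⟩ : ∃ e : Q × Γ × Q → ℝ≥0, ∀ p Z q, Δ.firstMoment p Z q = e (p, Z, q) :=
    ⟨fun j => (Δ.firstMoment j.1 j.2.1 j.2.2).toNNReal,
      fun p Z q => (ENNReal.coe_toNNReal (hc.firstMoment_ne_top hfin p Z q)).symm⟩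
  have hlfp : (fun j => (Δ.fundamentalPPS.lfp j).toNNReal) = μ :=
    funext fun j => by rw [fundamentalPPS_lfp, hμ, ENNReal.toNNReal_coe]
  have hvec : Δ.momentVec = fun j => (e j : ℝ) :=
    funext fun j => by rw [momentVec, he, ENNReal.coe_toReal]
  ext ⟨p, Z, q⟩
  have h := Δ.firstMoment_eq_returnProb_add p Z q
  simp only [hμ, he] at h
  rw [Pi.add_apply, hvec, PPS.jacobiLfp, hlfp, PPS.jacobi_mulVec, returnVec, hμ,
    ENNReal.coe_toReal, eval_directionalDeriv_fundamentalPPS, add_comm]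
  dsimp only
  exact_mod_cast h.symm

theorem cleanPPS_jacobiLfp_mulVec_momentVec_add :
    Δ.cleanPPS.jacobiLfp *ᵥ (fun j => Δ.momentVec j.1) + (fun j => Δ.returnVec j.1)
      = fun j => Δ.momentVec j.1 := by
  have hzero (j) (hj : Δ.fundamentalPPS.lfp j = 0) : Δ.momentVec j = 0 := by
    rw [momentVec, firstMoment, terminationMoment_one_eq_zero (lfp_eq_zero_iff.mp hj),
      ENNReal.toReal_zero]
  funext j
  rw [Pi.add_apply, PPS.clean_jacobiLfp_mulVec _ hzero]
  exact congrFun (jacobiLfp_mulVec_momentVec_add hfin hc) j.1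

theorem momentVec_pos (j : Δ.fundamentalPPS.CleanIndex) : 0 < Δ.momentVec j.1 :=
  (returnVec_pos hfin j).trans_le
    (ENNReal.toReal_mono (hc.firstMoment_ne_top hfin _ _ _) (returnProb_le_firstMoment _ _ _))

theorem momentVec_le (j : Δ.fundamentalPPS.CleanIndex) :
    Δ.momentVec j.1 ≤ Δ.maxCondRuntime.toReal * Δ.returnVec j.1 := by
  rw [momentVec, ← condRuntime_mul_returnProb hfin, ENNReal.toReal_mul]
  exact mul_le_mul_of_nonneg_right (ENNReal.toReal_mono hc.maxCondRuntime_lt_top.ne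
    (condRuntime_le_maxCondRuntime (returnProb_pos j))) (returnVec_pos hfin j).le

theorem cleanPPS_jacobiLfp_mulVec_momentVec_le (hpos : ∃ p Z q, 0 < Δ.returnProb p Z q)
    (i : Δ.fundamentalPPS.CleanIndex) :
    (Δ.cleanPPS.jacobiLfp *ᵥ fun j => Δ.momentVec j.1) i
      ≤ (1 - Δ.maxCondRuntime.toReal⁻¹) * Δ.momentVec i.1 :=
  mulVec_le_of_mulVec_add_eq (maxCondRuntime_toReal_pos hfin hc hpos)
    (cleanPPS_jacobiLfp_mulVec_momentVec_add hfin hc) (momentVec_le hfin hc) i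

theorem specRad_cleanPPS_jacobiLfp_le (hpos : ∃ p Z q, 0 < Δ.returnProb p Z q) :
    specRad Δ.cleanPPS.jacobiLfp ≤ ENNReal.ofReal (1 - Δ.maxCondRuntime.toReal⁻¹) :=
  specRad_le_of_mulVec_le (PPS.jacobiLfp_nonneg _) (momentVec_pos hfin hc)
    (cleanPPS_jacobiLfp_mulVec_momentVec_le hfin hc hpos)

theorem specRad_cleanPPS_jacobiLfp_eq (hpos : ∃ p Z q, 0 < Δ.returnProb p Z q)
    (h : ∀ p Z q, 0 < Δ.returnProb p Z q → Δ.condRuntime p Z q = Δ.maxCondRuntime) :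
    specRad Δ.cleanPPS.jacobiLfp = ENNReal.ofReal (1 - Δ.maxCondRuntime.toReal⁻¹) := by
  refine (specRad_cleanPPS_jacobiLfp_le hfin hc hpos).antisymm
    (ofReal_le_specRad_of_mulVec_eq_smul (v := fun j => Δ.momentVec j.1) ?_ ?_)
  · obtain ⟨j⟩ := nonempty_cleanIndex hpos
    exact fun h₀ => (momentVec_pos hfin hc j).ne' (congrFun h₀ j)
  · have hC := maxCondRuntime_toReal_pos hfin hc hpos
    funext j
    have hj := congrFun (cleanPPS_jacobiLfp_mulVec_momentVec_add hfin hc) j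
    have hE : Δ.momentVec j.1 = Δ.maxCondRuntime.toReal * Δ.returnVec j.1 := by
      rw [momentVec, ← condRuntime_mul_returnProb hfin, h _ _ _ (returnProb_pos j),
        ENNReal.toReal_mul, returnVec]
    rw [Pi.add_apply, ← eq_sub_iff_add_eq] at hj
    rw [hj, Pi.smul_apply, smul_eq_mul, sub_mul, one_mul, hE, inv_mul_cancel_left₀ hC.ne']

theorem sum_momentVec_le :
    ∑ j : Δ.fundamentalPPS.CleanIndex, Δ.momentVec j.1
      ≤ Δ.maxCondRuntime.toReal * ∑ j : Q × Γ × Q, Δ.returnVec j :=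
  calc ∑ j : Δ.fundamentalPPS.CleanIndex, Δ.momentVec j.1
      ≤ ∑ j : Δ.fundamentalPPS.CleanIndex, Δ.maxCondRuntime.toReal * Δ.returnVec j.1 :=
        Finset.sum_le_sum fun j _ => momentVec_le hfin hc j
    _ = Δ.maxCondRuntime.toReal * ∑ j : Q × Γ × Q, Δ.returnVec j := by
        rw [← Finset.mul_sum, sum_cleanIndex_returnVec]

theorem minReturnProb_toReal_le_momentVec (j : Δ.fundamentalPPS.CleanIndex) :
    Δ.minReturnProb.toReal ≤ Δ.momentVec j.1 :=
  ENNReal.toReal_mono (hc.firstMoment_ne_top hfin _ _ _)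
    ((minReturnProb_le_returnProb (returnProb_pos j)).trans (returnProb_le_firstMoment _ _ _))

end Finite

theorem IsProbabilistic.returnProb_le_one [Fintype Q] (hΔ : Δ.IsProbabilistic) (p : Q) (Z : Γ)
    (q : Q) : Δ.returnProb p Z q ≤ 1 :=
  terminationMoment_zero_le_one (fun s _ => hΔ.tsum_transMatrix_le_one s) _

theorem IsProbabilistic.sum_returnProb_le [Fintype Q] (hΔ : Δ.IsProbabilistic) :
    ∑ j : Q × Γ × Q, Δ.returnProb j.1 j.2.1 j.2.2
      ≤ ((Fintype.card Q ^ 2 * Fintype.card Γ : ℝ≥0) : ℝ≥0∞) := by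
  calc ∑ j : Q × Γ × Q, Δ.returnProb j.1 j.2.1 j.2.2
      ≤ ∑ _j : Q × Γ × Q, 1 := Finset.sum_le_sum fun j _ => hΔ.returnProb_le_one _ _ _
    _ = ((Fintype.card Q ^ 2 * Fintype.card Γ : ℝ≥0) : ℝ≥0∞) := by
      simp only [Finset.sum_const, Finset.card_univ, Fintype.card_prod, nsmul_one]
      push_cast
      ring

end WeightedPDA

/-! ### The branching automaton -/

section Branching

variable {a : ℚ≥0}

@[simp]
theorem branchingPDA_pop (a : ℚ≥0) (p Z q : Unit) : (branchingPDA a).pop p Z q = a :=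
  rfl

@[simp]
theorem branchingPDA_swap (a : ℚ≥0) (p Z q Y : Unit) : (branchingPDA a).swap p Z q Y = 0 :=
  rfl

@[simp]
theorem branchingPDA_push (a : ℚ≥0) (p Z q Y X : Unit) :
    (branchingPDA a).push p Z q Y X = 1 - a :=
  rfl

theorem isProbabilistic_branchingPDA (ha : a ≤ 1) : (branchingPDA a).IsProbabilistic :=
  fun p Z => by simp [add_tsub_cancel_of_le ha]

theorem coe_nnratCast_one_sub (ha : a ≤ 1) : (((1 - a : ℚ≥0) : ℝ≥0) : ℝ) = 1 - a := by
  change ((1 - a : ℚ≥0) : ℝ) = 1 - a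
  rw [eq_sub_iff_add_eq]
  exact_mod_cast tsub_add_cancel_of_le ha

theorem half_lt_nnratCast (ha : 1 / 2 < a) : 1 / 2 < (a : ℝ) := by
  have h : ((1 / 2 : ℚ≥0) : ℝ) < a := by exact_mod_cast ha
  simpa using h

theorem branchingPDA_returnProb_eq (a : ℚ≥0) :
    (branchingPDA a).returnProb () () ()
      = (a : ℝ≥0) + ((1 - a : ℚ≥0) : ℝ≥0) * (branchingPDA a).returnProb () () () ^ 2 := by
  conv_lhs => rw [WeightedPDA.returnProb_eq_toFun, WeightedPDA.fundamentalPPS_toFun]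
  simp [sq]

theorem branchingPDA_firstMoment_eq (a : ℚ≥0) :
    (branchingPDA a).firstMoment () () ()
      = (branchingPDA a).returnProb () () () + ((1 - a : ℚ≥0) : ℝ≥0)
        * (2 * (branchingPDA a).returnProb () () () * (branchingPDA a).firstMoment () () ()) := by
  conv_lhs => rw [WeightedPDA.firstMoment_eq_returnProb_add]
  simp [two_mul, add_mul]

theorem eq_one_of_eq_add_mul_sq {a r : ℝ} (ha : 1 / 2 < a) (ha' : a ≤ 1) (hr : r ≤ 1)
    (h : r = a + (1 - a) * r ^ 2) : r = 1 := by
  have hprod : (1 - r) * (a - (1 - a) * r) = 0 := by linear_combination -h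
  rcases mul_eq_zero.mp hprod with h | h
  · linarith
  · linarith [mul_le_mul_of_nonneg_left hr (sub_nonneg.mpr ha')]

theorem branchingPDA_returnProb (ha : 1 / 2 < a) (ha' : a ≤ 1) (p Z q : Unit) :
    (branchingPDA a).returnProb p Z q = 1 := by
  have hle := (isProbabilistic_branchingPDA ha').returnProb_le_one p Z q
  have hr := branchingPDA_returnProb_eq a
  lift (branchingPDA a).returnProb () () () to ℝ≥0 using (hle.trans_lt ENNReal.one_lt_top).ne
    with r
  have hr' : (r : ℝ) = a + (1 - a) * r ^ 2 := by
    rw [← coe_nnratCast_one_sub ha']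
    change (r : ℝ) = ((a : ℝ≥0) : ℝ) + _
    exact_mod_cast hr
  exact_mod_cast eq_one_of_eq_add_mul_sq (half_lt_nnratCast ha) (by exact_mod_cast ha')
    (by exact_mod_cast hle) hr'

theorem eq_one_add_mul_two_mul_iff (ha : 1 / 2 < a) (ha' : a ≤ 1) {x : ℝ≥0∞} (hx : x ≠ ⊤) :
    x = 1 + ((1 - a : ℚ≥0) : ℝ≥0) * (2 * x) ↔ x = ENNReal.ofReal (1 / (2 * (a : ℝ) - 1)) := by
  have h₁ := half_lt_nnratCast ha
  lift x to ℝ≥0 using hx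
  rw [← ENNReal.toReal_eq_toReal_iff' ENNReal.coe_ne_top ENNReal.ofReal_ne_top,
    ENNReal.toReal_ofReal (one_div_nonneg.mpr (by linarith)), eq_div_iff (by linarith)]
  have h : (x : ℝ) = 1 + (1 - a) * (2 * x) ↔ (x : ℝ) * (2 * a - 1) = 1 :=
    ⟨fun h => by linear_combination h, fun h => by linear_combination h⟩
  rw [ENNReal.coe_toReal, ← h, ← coe_nnratCast_one_sub ha']
  norm_cast

theorem branchingPDA_firstMoment_le (ha : 1 / 2 < a) (ha' : a ≤ 1) (p Z q : Unit) :
    (branchingPDA a).firstMoment p Z q ≤ ENNReal.ofReal (1 / (2 * (a : ℝ) - 1)) := by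
  have hprob := isProbabilistic_branchingPDA ha'
  have hw := (eq_one_add_mul_two_mul_iff ha ha' ENNReal.ofReal_ne_top).mpr rfl
  set w := ENNReal.ofReal (1 / (2 * (a : ℝ) - 1))
  have h₁ : ((a : ℝ≥0) : ℝ≥0∞) + ((1 - a : ℚ≥0) : ℝ≥0) = 1 := by
    exact_mod_cast congrArg (NNRat.cast : ℚ≥0 → ℝ≥0) (add_tsub_cancel_of_le ha')
  -- The expected height of the stack drops by `2a - 1` in every step.
  refine (terminationMoment_one_le_of_drift (h := fun s => s.2.length * w) ?_ _).trans ?_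
  · rintro ⟨⟨⟩, _ | ⟨⟨⟩, β⟩⟩ hs
    · exact absurd rfl hs
    calc terminationMoment (branchingPDA a).transMatrix 0 ((), () :: β) {((), [])}
          + ∑' t, ((branchingPDA a).transMatrix ((), () :: β) t : ℝ≥0∞) * (t.2.length * w)
        ≤ 1 + ((a : ℝ≥0) * (β.length * w) + ((1 - a : ℚ≥0) : ℝ≥0) * ((β.length + 2) * w)) := by
          refine add_le_add
            (terminationMoment_zero_le_one (fun s _ => hprob.tsum_transMatrix_le_one s) _)
            (le_of_eq ?_)
          rw [WeightedPDA.tsum_transMatrix_mul, WeightedPDA.sum_move]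
          simp [WeightedPDA.moveWeight, WeightedPDA.Move.word, add_assoc, one_add_one_eq_two]
      _ = ((a : ℝ≥0) + ((1 - a : ℚ≥0) : ℝ≥0)) * (β.length * w)
          + (1 + ((1 - a : ℚ≥0) : ℝ≥0) * (2 * w)) := by ring
      _ = (() :: β).length * w := by
          rw [← hw, h₁, List.length_cons]
          push_cast
          ring
  · simp

theorem branchingPDA_firstMoment (ha : 1 / 2 < a) (ha' : a ≤ 1) (p Z q : Unit) :
    (branchingPDA a).firstMoment p Z q = ENNReal.ofReal (1 / (2 * (a : ℝ) - 1)) := by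
  have hne := ne_top_of_le_ne_top ENNReal.ofReal_ne_top (branchingPDA_firstMoment_le ha ha' p Z q)
  have h := branchingPDA_firstMoment_eq a
  rw [branchingPDA_returnProb ha ha', mul_one] at h
  exact (eq_one_add_mul_two_mul_iff ha ha' hne).mp h

theorem branchingPDA_condRuntime (ha : 1 / 2 < a) (ha' : a ≤ 1) (p Z q : Unit) :
    (branchingPDA a).condRuntime p Z q = ENNReal.ofReal (1 / (2 * (a : ℝ) - 1)) := by
  rw [WeightedPDA.condRuntime, branchingPDA_returnProb ha ha', div_one,
    branchingPDA_firstMoment ha ha']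

theorem isCPAST_branchingPDA (ha : 1 / 2 < a) (ha' : a ≤ 1) : (branchingPDA a).IsCPAST :=
  fun p Z q _ => (branchingPDA_condRuntime ha ha' p Z q).trans_lt ENNReal.ofReal_lt_top

theorem branchingPDA_maxCondRuntime (ha : 1 / 2 < a) (ha' : a ≤ 1) :
    (branchingPDA a).maxCondRuntime = ENNReal.ofReal (1 / (2 * (a : ℝ) - 1)) := by
  simp only [WeightedPDA.maxCondRuntime, branchingPDA_returnProb ha ha',
    branchingPDA_condRuntime ha ha', zero_lt_one, iSup_pos, ciSup_const]

theorem one_sub_inv_maxCondRuntime_branchingPDA (ha : 1 / 2 < a) (ha' : a ≤ 1) :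
    1 - (branchingPDA a).maxCondRuntime.toReal⁻¹ = 2 * (1 - (a : ℝ)) := by
  have h₁ := half_lt_nnratCast ha
  rw [branchingPDA_maxCondRuntime ha ha', ENNReal.toReal_ofReal (one_div_nonneg.mpr (by linarith)),
    one_div, inv_inv]
  ring

theorem specRad_branchingPDA (ha : 1 / 2 < a) (ha' : a ≤ 1) :
    specRad (branchingPDA a).cleanPPS.jacobiLfp
      = ENNReal.ofReal (1 - (branchingPDA a).maxCondRuntime.toReal⁻¹) := by
  refine WeightedPDA.specRad_cleanPPS_jacobiLfp_eq (fun p Z q => ?_) (isCPAST_branchingPDA ha ha')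
    ⟨(), (), (), ?_⟩ fun p Z q _ => ?_
  · rw [branchingPDA_returnProb ha ha']
    exact ENNReal.one_ne_top
  · rw [branchingPDA_returnProb ha ha']
    exact one_pos
  · rw [branchingPDA_condRuntime ha ha', branchingPDA_maxCondRuntime ha ha']

end Branching

open WeightedPDA in
theorem lemma10_general {Q Γ : Type*} [Fintype Q] [Fintype Γ] [DecidableEq Γ]
    (Δ : WeightedPDA Q Γ) (B : ℝ≥0)
    (hB : ∑ j : Q × Γ × Q, Δ.returnProb j.1 j.2.1 j.2.2 ≤ B) (hc : Δ.IsCPAST)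
    (hpos : ∃ p Z q, 0 < Δ.returnProb p Z q) :
    (1 ≤ Δ.maxCondRuntime ∧ Δ.maxCondRuntime < ⊤) ∧
    (∀ j, Δ.cleanPPS.lfp j < ⊤) ∧
    (∃ v : Δ.fundamentalPPS.CleanIndex → ℝ,
      (∀ j, 0 < v j) ∧
      (∑ j, |v j| = 1) ∧
      (∀ i, (Δ.cleanPPS.jacobiLfp.mulVec v) i ≤ (1 - Δ.maxCondRuntime.toReal⁻¹) * v i) ∧
      (∀ j, Δ.minReturnProb.toReal / (Δ.maxCondRuntime.toReal * B) ≤ v j)) ∧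
    specRad Δ.cleanPPS.jacobiLfp ≤ ENNReal.ofReal (1 - Δ.maxCondRuntime.toReal⁻¹) := by
  have hfin (p Z q) : Δ.returnProb p Z q ≠ ⊤ :=
    ENNReal.sum_ne_top.mp (ne_top_of_le_ne_top ENNReal.coe_ne_top hB) (p, Z, q)
      (Finset.mem_univ _)
  have : Nonempty Δ.fundamentalPPS.CleanIndex := nonempty_cleanIndex hpos
  obtain ⟨v, hv, hv₁, hAv, hvE⟩ := exists_sum_abs_eq_one_of_mulVec_le (momentVec_pos hfin hc)
    (cleanPPS_jacobiLfp_mulVec_momentVec_le hfin hc hpos)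
  refine ⟨⟨one_le_maxCondRuntime hfin hpos, hc.maxCondRuntime_lt_top⟩, fun j => ?_,
    ⟨v, hv, hv₁, hAv, fun j => ?_⟩, specRad_cleanPPS_jacobiLfp_le hfin hc hpos⟩
  · rw [PPS.clean_lfp, fundamentalPPS_lfp]
    exact (hfin _ _ _).lt_top
  · have hsum : ∑ i : Δ.fundamentalPPS.CleanIndex, Δ.momentVec i.1
        ≤ Δ.maxCondRuntime.toReal * B :=
      (sum_momentVec_le hfin hc).trans
        (mul_le_mul_of_nonneg_left (sum_returnVec_le hB) ENNReal.toReal_nonneg)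
    rw [hvE]
    exact div_le_div₀ (momentVec_pos hfin hc j).le (minReturnProb_toReal_le_momentVec hfin hc j)
      (Finset.sum_pos (fun i _ => momentVec_pos hfin hc i) Finset.univ_nonempty) hsum

theorem lemma10 :
    -- the bound, for every conditionally PAST probabilistic pushdown automaton with at least one
    -- positive return probability
    (∀ (Q Γ : Type*) [Fintype Q] [Fintype Γ] [DecidableEq Γ]
        (Δ : WeightedPDA Q Γ), Δ.IsProbabilistic → Δ.IsCPAST →
        (∃ p Z q, 0 < Δ.returnProb p Z q) →
      (1 ≤ Δ.maxCondRuntime ∧ Δ.maxCondRuntime < ⊤) ∧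
      (∀ j, Δ.cleanPPS.lfp j < ⊤) ∧
      (∃ v : Δ.fundamentalPPS.CleanIndex → ℝ,
        (∀ j, 0 < v j) ∧
        (∑ j, |v j| = 1) ∧
        (∀ i, (Δ.cleanPPS.jacobiLfp.mulVec v) i ≤ (1 - Δ.maxCondRuntime.toReal⁻¹) * v i) ∧
        (∀ j, Δ.minReturnProb.toReal /
            (Δ.maxCondRuntime.toReal * (Fintype.card Q : ℝ) ^ 2 * (Fintype.card Γ : ℝ)) ≤ v j)) ∧
      specRad Δ.cleanPPS.jacobiLfp ≤ ENNReal.ofReal (1 - Δ.maxCondRuntime.toReal⁻¹)) ∧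
    -- tightness of the bound on the spectral radius
    (∀ a : ℚ≥0, 1 / 2 < a → a ≤ 1 →
      (branchingPDA a).IsProbabilistic ∧ (branchingPDA a).IsCPAST ∧
      (branchingPDA a).maxCondRuntime = ENNReal.ofReal (1 / (2 * (a : ℝ) - 1)) ∧
      specRad (branchingPDA a).cleanPPS.jacobiLfp = ENNReal.ofReal (2 * (1 - (a : ℝ))) ∧
      specRad (branchingPDA a).cleanPPS.jacobiLfp =
        ENNReal.ofReal (1 - (branchingPDA a).maxCondRuntime.toReal⁻¹)) := by
  refine ⟨fun Q Γ _ _ _ Δ hΔ hc hpos => ?_, fun a ha ha' => ?_⟩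
  · simpa only [NNReal.coe_mul, NNReal.coe_pow, NNReal.coe_natCast, mul_assoc] using
      lemma10_general Δ _ hΔ.sum_returnProb_le hc hpos
  · have hspec := specRad_branchingPDA ha ha'
    exact ⟨isProbabilistic_branchingPDA ha', isCPAST_branchingPDA ha ha',
      branchingPDA_maxCondRuntime ha ha',
      by rw [hspec, one_sub_inv_maxCondRuntime_branchingPDA ha ha'], hspec⟩
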